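/- Let $\mathcal H_A,\mathcal H_B$ be complex Hilbert spaces (of arbitrary dimension) and let $\theta_{AB}$ be a state on $\mathcal H_A\otimes\mathcal H_B$, i.e. a positive semi-definite operator of trace one, with marginals $\theta_A=\operatorname{Tr}_B\theta_{AB}$ and $\theta_B=\operatorname{Tr}_A\theta_{AB}$. For positive semi-definite $P,Q$ let $F(P,Q)=\|\sqrt P\sqrt Q\|_1^2$, where $\|C\|_1=\operatorname{Tr}\sqrt{C^\dagger C}$, and for subnormalized states $\rho,\sigma$ (positive semi-definite, trace at most one) let $$P(\rho,\sigma)=\sqrt{1-F\bigl(\rho\oplus[1-\operatorname{Tr}\rho],\ \sigma\oplus[1-\operatorname{Tr}\sigma]\bigr)}$$ be the purified distance. Let $D_{\max}(\omega\Vert\tau)=\inf\{\lambda\in\mathbb R:\omega\le 2^\lambda\tau\}$ and $$D_{\max}^{\delta}(\omega\Vert\tau)=\inf\{\lambda\in\mathbb R:\widetilde\omega\le 2^\lambda\tau \text{ for some subnormalized state }\widetilde\omega\text{ with }P(\omega,\widetilde\omega)\le\delta\},$$ with $\inf\emptyset=+\infty$, and let $$\widetilde I_{\max}^{\varepsilon}(B;A)_\theta=\inf_{\theta'_{AB}\,:\,P(\theta'_{AB},\theta_{AB})\le\varepsilon}D_{\max}(\theta'_{AB}\Vert\theta_A\otimes\theta'_B),$$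 the infimum being over all (normalized) states $\theta'_{AB}$ on $\mathcal H_A\otimes\mathcal H_B$, where $\theta'_B=\operatorname{Tr}_A\theta'_{AB}$. Then, for all $\varepsilon\in(0,1)$ and $\gamma\in(0,\varepsilon)$, as an inequality in $[-\infty,+\infty]$, $$\widetilde I_{\max}^{\varepsilon}(B;A)_\theta\ \le\ D_{\max}^{\varepsilon-\gamma}(\theta_{AB}\Vert\theta_A\otimes\theta_B)+\log_2\!\left(\frac{3}{\gamma^2}\right).$$ -/

import Mathlib

open scoped TensorProduct InnerProductSpace ENNReal

noncomputable section

namespace QIT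

universe u v

variable {H : Type u} [NormedAddCommGroup H] [InnerProductSpace ℂ H] [CompleteSpace H]
variable {K : Type v} [NormedAddCommGroup K] [InnerProductSpace ℂ K] [CompleteSpace K]

/-! ### Trace, trace norm, density operators -/

variable (H) in
/-- The underlying set of a fixed orthonormal (Hilbert) basis of `H`. -/
def basisSet : Set H := Classical.choose (exists_hilbertBasis ℂ H)

variable (H) in
/-- A fixed orthonormal (Hilbert) basis of `H`. -/
def basis : HilbertBasis (basisSet H) ℂ H :=
  Classical.choose (Classical.choose_spec (exists_hilbertBasis ℂ H))

/-- The trace `∑ᵢ ⟪eᵢ, T eᵢ⟫ ∈ [0, ∞]` of a positive semi-definite operator `T`. It does not depend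
on the orthonormal basis, see `posTrace_eq`. It is used for positive semi-definite operators only. -/
def posTrace (T : H →L[ℂ] H) : ℝ≥0∞ :=
  ∑' i, ENNReal.ofReal (⟪basis H i, T (basis H i)⟫_ℂ).re

/-- The Parseval identity. -/
theorem parseval {E : Type*} [NormedAddCommGroup E] [InnerProductSpace ℂ E]
    {ι : Type*} (b : HilbertBasis ι ℂ E) (x : E) :
    ∑' i, ENNReal.ofReal (‖⟪b i, x⟫_ℂ‖ ^ 2) = ENNReal.ofReal (‖x‖ ^ 2) := by
  have h := b.hasSum_inner_mul_inner x x
  have h2 : HasSum (fun i => ‖⟪b i, x⟫_ℂ‖ ^ 2) (‖x‖ ^ 2) := by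
    have h3 := Complex.hasSum_re h
    have e1 : (⟪x, x⟫_ℂ).re = ‖x‖ ^ 2 := by
      rw [inner_self_eq_norm_sq_to_K]; norm_cast
    rw [e1] at h3
    convert h3 using 2 with i
    rw [← inner_conj_symm x (b i), RCLike.conj_mul]
    norm_cast
  rw [← h2.tsum_eq, ENNReal.ofReal_tsum_of_nonneg (fun _ => by positivity) h2.summable]

/-- The trace of a positive semi-definite operator can be computed in any orthonormal basis. -/
theorem posTrace_eq {T : H →L[ℂ] H} (hT : 0 ≤ T) {ι : Type*} (c : HilbertBasis ι ℂ H) :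
    posTrace T = ∑' i, ENNReal.ofReal (⟪c i, T (c i)⟫_ℂ).re := by
  have hS : 0 ≤ CFC.sqrt T := CFC.sqrt_nonneg T
  have hadj : (CFC.sqrt T).adjoint = CFC.sqrt T := (IsSelfAdjoint.of_nonneg hS).star_eq
  have key : ∀ x : H, (⟪x, T x⟫_ℂ).re = ‖CFC.sqrt T x‖ ^ 2 := by
    intro x
    have h1 : T x = CFC.sqrt T (CFC.sqrt T x) := by
      rw [← mul_apply_eq_comp, CFC.sqrt_mul_sqrt_self T hT]
    rw [h1, ← ContinuousLinearMap.adjoint_inner_left, hadj, inner_self_eq_norm_sq_to_K]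
    norm_cast
  have sw : ∀ x y : H, ‖⟪x, CFC.sqrt T y⟫_ℂ‖ = ‖⟪y, CFC.sqrt T x⟫_ℂ‖ := by
    intro x y
    rw [← ContinuousLinearMap.adjoint_inner_left, hadj, norm_inner_symm]
  simp only [posTrace, key]
  calc _ = ∑' i, ∑' j, ENNReal.ofReal (‖⟪c j, CFC.sqrt T (basis H i)⟫_ℂ‖ ^ 2) := by
        simp only [parseval]
    _ = ∑' j, ∑' i, ENNReal.ofReal (‖⟪basis H i, CFC.sqrt T (c j)⟫_ℂ‖ ^ 2) := by
        rw [ENNReal.tsum_comm]; simp only [sw (c _)]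
    _ = _ := by simp only [parseval]

/-- The trace norm `‖C‖₁ = Tr √(C† C)`, where `CFC.abs C = √(C† C)`. -/
def traceNorm (C : H →L[ℂ] H) : ℝ≥0∞ := posTrace (CFC.abs C)

/-- Density operators (states): positive semi-definite with trace one. -/
structure IsState (ρ : H →L[ℂ] H) : Prop where
  nonneg : 0 ≤ ρ
  trace_eq_one : posTrace ρ = 1

/-- Subnormalized density operators: positive semi-definite with trace at most one. -/
structure IsSubstate (ρ : H →L[ℂ] H) : Prop where
  nonneg : 0 ≤ ρ
  trace_le_one : posTrace ρ ≤ 1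

/-! ### Fidelity and purified distance -/

/-- The fidelity `F(ρ, σ) = ‖√ρ √σ‖₁ ²`. -/
def fidelity (ρ σ : H →L[ℂ] H) : ℝ := (traceNorm (CFC.sqrt ρ * CFC.sqrt σ)).toReal ^ 2

/-- The sine distance `C(ρ, σ) = √(1 - F(ρ, σ))`. -/
def sineDist (ρ σ : H →L[ℂ] H) : ℝ := Real.sqrt (1 - fidelity ρ σ)

/-- The direct sum `T ⊕ S` acting on the Hilbert space direct sum of `H` and `K`. -/
def directSum (T : H →L[ℂ] H) (S : K →L[ℂ] K) : WithLp 2 (H × K) →L[ℂ] WithLp 2 (H × K) :=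
  ((WithLp.prodContinuousLinearEquiv 2 ℂ H K).symm : (H × K) →L[ℂ] WithLp 2 (H × K)) ∘L
    (T.prodMap S) ∘L
    ((WithLp.prodContinuousLinearEquiv 2 ℂ H K) : WithLp 2 (H × K) →L[ℂ] (H × K))

/-- The operator `ρ ⊕ [1 - Tr ρ]` on `H ⊕ ℂ`. -/
def normalize (ρ : H →L[ℂ] H) : WithLp 2 (H × ℂ) →L[ℂ] WithLp 2 (H × ℂ) :=
  directSum ρ ((1 - (posTrace ρ).toReal) • ContinuousLinearMap.id ℂ ℂ)

/-- The purified distance of (subnormalized) states,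
`P(ρ, σ) = C(ρ ⊕ [1 - Tr ρ], σ ⊕ [1 - Tr σ])`. -/
def purifiedDist (ρ σ : H →L[ℂ] H) : ℝ := sineDist (normalize ρ) (normalize σ)

/-! ### Max-relative entropy -/

/-- The max-relative entropy `inf {l ∈ ℝ : ω ≤ 2 ^ l τ}`, equal to `+∞` if there is no such `l`;
the order is the Loewner order. -/
def dMax (ω τ : H →L[ℂ] H) : EReal :=
  sInf ((fun l : ℝ => (l : EReal)) '' {l : ℝ | ω ≤ ((2 : ℝ) ^ l) • τ})

/-- The smooth max-relative entropy `inf {l ∈ ℝ : ω' ≤ 2 ^ l τ ∧ P(ω, ω') ≤ ε}`, with `ω'` ranging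
over the subnormalized states; equal to `+∞` if there is no such `l`. -/
def smoothDMax (ε : ℝ) (ω τ : H →L[ℂ] H) : EReal :=
  sInf ((fun l : ℝ => (l : EReal)) ''
    {l : ℝ | ∃ ω' : H →L[ℂ] H, IsSubstate ω' ∧ ω' ≤ ((2 : ℝ) ^ l) • τ ∧ purifiedDist ω ω' ≤ ε})

/-! ### Bipartite systems -/

variable (H K) in
/-- The tensor product of Hilbert spaces: the completion of the algebraic tensor product. -/
abbrev HTensor : Type (max u v) := UniformSpace.Completion (H ⊗[ℂ] K)

/-- The operator `T ⊗ S`, determined by `(T ⊗ S) (x ⊗ y) = T x ⊗ S y`. -/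
def tensorOp (T : H →L[ℂ] H) (S : K →L[ℂ] K) : HTensor H K →L[ℂ] HTensor H K :=
  (TensorProduct.mapL T S).completion

/-- The operator `H → H ⊗ K`, `x ↦ x ⊗ y`. -/
def tensorRight (y : K) : H →L[ℂ] HTensor H K :=
  UniformSpace.Completion.toComplL ∘L ((TensorProduct.mkL ℂ H K).flip y)

/-- The operator `K → H ⊗ K`, `y ↦ x ⊗ y`. -/
def tensorLeft (x : H) : K →L[ℂ] HTensor H K :=
  UniformSpace.Completion.toComplL ∘L (TensorProduct.mkL ℂ H K x)

/-- The marginal on the first factor (the second one is traced out):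
`ρ_A = ∑ⱼ (1 ⊗ ⟨fⱼ|) ρ (1 ⊗ |fⱼ⟩)` for an orthonormal basis `f` of the second factor. For a
state, the series converges absolutely in operator norm. -/
def marginalA (ρ : HTensor H K →L[ℂ] HTensor H K) : H →L[ℂ] H :=
  ∑' j, (tensorRight (H := H) (basis K j)).adjoint ∘L ρ ∘L tensorRight (basis K j)

/-- The marginal on the second factor (the first one is traced out):
`ρ_B = ∑ᵢ (⟨eᵢ| ⊗ 1) ρ (|eᵢ⟩ ⊗ 1)` for an orthonormal basis `e` of the first factor. For a
state, the series converges absolutely in operator norm. -/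
def marginalB (ρ : HTensor H K →L[ℂ] HTensor H K) : K →L[ℂ] K :=
  ∑' i, (tensorLeft (K := K) (basis H i)).adjoint ∘L ρ ∘L tensorLeft (basis H i)

/-- The alternate smooth max-mutual information of a state `θ_AB`: the infimum of
`D_max(θ'_AB ‖ θ_A ⊗ θ'_B)` over all states `θ'_AB` with `P(θ'_AB, θ_AB) ≤ ε`. -/
def altSmoothIMax (ε : ℝ) (θ : HTensor H K →L[ℂ] HTensor H K) : EReal :=
  ⨅ (θ' : HTensor H K →L[ℂ] HTensor H K) (_ : IsState θ') (_ : purifiedDist θ' θ ≤ ε),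
    dMax θ' (tensorOp (marginalA θ) (marginalB θ'))

end QIT

end

open scoped TensorProduct InnerProductSpace ENNReal

noncomputable section

namespace QIT

universe u v

variable {H : Type u} [NormedAddCommGroup H] [InnerProductSpace ℂ H] [CompleteSpace H]
variable {K : Type v} [NormedAddCommGroup K] [InnerProductSpace ℂ K] [CompleteSpace K]

/-! ### Properties of the trace -/

/-! Write `τ = θ_A ⊗ θ_B` and let `ω ≤ L τ`, with `L = 2 ^ l`, be a candidate for the smoothed
max-relative entropy. Bounding by `θ_A ⊗ θ'_B` requires the marginal of `θ'` to dominate a multiple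
of `θ_B`. This is forced by mixing in some `τ`: take `θ' = c ω + t τ` with `c = 1 - γ²` and `t = 1 -
c Tr ω ≥ γ²`, which has trace one. Then `θ'_B ≥ t θ_B`, so `t τ ≤ θ_A ⊗ θ'_B`, while `θ' ≤ (c L + t)
τ ≤ (3 L / γ²) t τ`.

The mixing costs little distance: the fidelity is monotone and homogeneous in its first argument, so
`F(θ', θ) ≥ c F(ω, θ) ≥ (1 - γ²)(1 - (ε - γ)²) ≥ 1 - ε²`. The weight `t` in `c L + t` is absorbed
because `L` cannot be small: `L ≥ Tr ω ≥ F(ω, θ)`. This argument is `exists_state_mix`.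

The remaining work is analytic and holds in any dimension: symmetry of the trace norm and its
Cauchy–Schwarz bound (`traceNorm_le_traceNorm_star`, `traceNorm_mul_le`), norm convergence of the
marginals, and removal of the extra summand in the purified distance (`fidelity_normalize`). -/

theorem inner_re_nonneg {T : H →L[ℂ] H} (hT : 0 ≤ T) (x : H) : 0 ≤ (⟪x, T x⟫_ℂ).re :=
  ((ContinuousLinearMap.nonneg_iff_isPositive T).1 hT).re_inner_nonneg_right x

theorem inner_re_mono {S T : H →L[ℂ] H} (h : S ≤ T) (x : H) :
    (⟪x, S x⟫_ℂ).re ≤ (⟪x, T x⟫_ℂ).re := by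
  have := inner_re_nonneg (sub_nonneg.2 h) x
  simpa [inner_sub_right] using this

theorem inner_adjoint_comp_self_re (A : H →L[ℂ] K) (x : H) :
    (⟪x, (A.adjoint ∘L A) x⟫_ℂ).re = ‖A x‖ ^ 2 := by
  rw [ContinuousLinearMap.comp_apply, ContinuousLinearMap.adjoint_inner_right,
    inner_self_eq_norm_sq_to_K]
  norm_cast

theorem smul_operator_nonneg {c : ℝ} (hc : 0 ≤ c) {T : H →L[ℂ] H} (hT : 0 ≤ T) : 0 ≤ c • T :=
  smul_nonneg hc hT

theorem conj_nonneg {T : H →L[ℂ] H} (hT : 0 ≤ T) (A : H →L[ℂ] K) :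
    0 ≤ A ∘L T ∘L A.adjoint :=
  (ContinuousLinearMap.nonneg_iff_isPositive _).2
    (((ContinuousLinearMap.nonneg_iff_isPositive _).1 hT).conj_adjoint A)

theorem adjoint_conj_nonneg {T : K →L[ℂ] K} (hT : 0 ≤ T) (A : H →L[ℂ] K) :
    0 ≤ A.adjoint ∘L T ∘L A :=
  (ContinuousLinearMap.nonneg_iff_isPositive _).2
    (((ContinuousLinearMap.nonneg_iff_isPositive _).1 hT).adjoint_conj A)

/-- Both sides are the double sum of the squared matrix entries; this is the source of the cyclicity
`posTrace_comp_adjoint`. -/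
theorem tsum_norm_sq_adjoint {ι κ : Type*} (b : HilbertBasis ι ℂ H) (c : HilbertBasis κ ℂ K)
    (A : H →L[ℂ] K) :
    ∑' i, ENNReal.ofReal (‖A (b i)‖ ^ 2) = ∑' j, ENNReal.ofReal (‖A.adjoint (c j)‖ ^ 2) := by
  calc _ = ∑' i, ∑' j, ENNReal.ofReal (‖⟪c j, A (b i)⟫_ℂ‖ ^ 2) := by simp only [parseval]
    _ = ∑' j, ∑' i, ENNReal.ofReal (‖⟪b i, A.adjoint (c j)⟫_ℂ‖ ^ 2) := by
        rw [ENNReal.tsum_comm]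
        simp only [ContinuousLinearMap.adjoint_inner_right, norm_inner_symm (c _)]
    _ = _ := by simp only [parseval]

theorem posTrace_adjoint_comp_self (A : H →L[ℂ] K) :
    posTrace (A.adjoint ∘L A) = ∑' i, ENNReal.ofReal (‖A (basis H i)‖ ^ 2) := by
  simp only [posTrace, inner_adjoint_comp_self_re]

theorem posTrace_comp_adjoint (A : H →L[ℂ] K) :
    posTrace (A ∘L A.adjoint) = posTrace (A.adjoint ∘L A) := by
  have := posTrace_adjoint_comp_self A.adjoint
  rw [ContinuousLinearMap.adjoint_adjoint] at this
  rw [posTrace_adjoint_comp_self, this, ← tsum_norm_sq_adjoint]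

theorem posTrace_mono {S T : H →L[ℂ] H} (h : S ≤ T) : posTrace S ≤ posTrace T :=
  ENNReal.tsum_le_tsum fun _ => ENNReal.ofReal_le_ofReal (inner_re_mono h _)

theorem posTrace_add {S T : H →L[ℂ] H} (hS : 0 ≤ S) (hT : 0 ≤ T) :
    posTrace (S + T) = posTrace S + posTrace T := by
  simp only [posTrace, ← ENNReal.tsum_add]
  congr 1 with i
  rw [← ENNReal.ofReal_add (inner_re_nonneg hS _) (inner_re_nonneg hT _)]
  simp

theorem posTrace_smul {c : ℝ} (hc : 0 ≤ c) (T : H →L[ℂ] H) :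
    posTrace (c • T) = ENNReal.ofReal c * posTrace T := by
  simp only [posTrace, ← ENNReal.tsum_mul_left, ← ENNReal.ofReal_mul hc]
  congr 1 with i
  simp [inner_smul_right_eq_smul]

theorem sum_inner_le_posTrace {T : H →L[ℂ] H} (hT : 0 ≤ T) (ht : posTrace T ≠ ∞)
    {ι : Type*} (c : HilbertBasis ι ℂ H) (s : Finset ι) :
    ∑ i ∈ s, (⟪c i, T (c i)⟫_ℂ).re ≤ (posTrace T).toReal := by
  rw [← ENNReal.ofReal_le_iff_le_toReal ht,
    ENNReal.ofReal_sum_of_nonneg fun _ _ => inner_re_nonneg hT _, posTrace_eq hT c]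
  exact ENNReal.sum_le_tsum s

theorem posTrace_le_of_sum_le {T : H →L[ℂ] H} (hT : 0 ≤ T) {r : ℝ}
    (h : ∀ s : Finset (basisSet H), ∑ i ∈ s, (⟪basis H i, T (basis H i)⟫_ℂ).re ≤ r) :
    posTrace T ≤ ENNReal.ofReal r := by
  rw [posTrace, ENNReal.tsum_eq_iSup_sum]
  refine iSup_le fun s => ?_
  rw [← ENNReal.ofReal_sum_of_nonneg fun i _ => inner_re_nonneg hT _]
  exact ENNReal.ofReal_le_ofReal (h s)

theorem sqrt_smul {c : ℝ} (hc : 0 ≤ c) {T : H →L[ℂ] H} (hT : 0 ≤ T) :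
    CFC.sqrt (c • T) = √c • CFC.sqrt T := by
  refine CFC.sqrt_unique ?_ (smul_nonneg (Real.sqrt_nonneg c) (CFC.sqrt_nonneg T))
  rw [smul_mul_smul_comm, CFC.sqrt_mul_sqrt_self T hT, Real.mul_self_sqrt hc]

/-! ### The trace norm -/

/-- A substitute for the polar decomposition: with `G = (|C| + η)⁻¹` and `R = √G`, the contraction
`C G` replaces the partial isometry, and `(C G)† C = |C|² (|C| + η)⁻¹` is within `η` of `|C|`. -/
theorem exists_approx_abs (C : H →L[ℂ] H) {η : ℝ} (hη : 0 < η) :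
    ∃ R G : H →L[ℂ] H, star R = R ∧ star G = G ∧ R * R = G ∧
      CFC.abs C - η • 1 ≤ star (C * R) * (C * R) ∧
      star (C * R) * (C * R) = star (C * G) * C ∧ star (C * G) * (C * G) ≤ 1 := by
  have ha0 : 0 ≤ CFC.abs C := CFC.abs_nonneg C
  have haa := CFC.abs_mul_abs C
  generalize CFC.abs C = a at ha0 haa
  have ha : IsSelfAdjoint a := IsSelfAdjoint.of_nonneg ha0
  have hsp : ∀ x ∈ spectrum ℝ a, 0 ≤ x := fun x hx => spectrum_nonneg_of_nonneg ha0 hx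
  -- The absolute value makes the functions continuous on all of `ℝ`; on the spectrum it changes
  -- nothing.
  have hne : ∀ x : ℝ, |x| + η ≠ 0 := fun x => by positivity
  have hc : Continuous fun x : ℝ => (|x| + η)⁻¹ := by fun_prop (disch := exact hne _)
  have hc' : Continuous fun x : ℝ => √((|x| + η)⁻¹) := hc.sqrt
  set R := cfc (fun x : ℝ => √((|x| + η)⁻¹)) a with hR
  set G := cfc (fun x : ℝ => (|x| + η)⁻¹) a with hG
  have hRs : star R = R := (cfc_predicate _ a : IsSelfAdjoint R)
  have hGs : star G = G := (cfc_predicate _ a : IsSelfAdjoint G)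
  have hRR : R * R = G := by
    rw [hR, ← cfc_mul _ _ a hc'.continuousOn hc'.continuousOn, hG]
    exact cfc_congr fun x _ => Real.mul_self_sqrt (by positivity)
  have hid : cfc (fun x : ℝ => x) a = a := cfc_id' ℝ a
  have hGa : G * (a * a) = cfc (fun x : ℝ => (|x| + η)⁻¹ * (x * x)) a := by
    rw [cfc_mul _ _ a hc.continuousOn (by fun_prop), cfc_mul _ _ a (by fun_prop) (by fun_prop),
      hid]
  have hRaR : R * (a * a) * R = G * (a * a) := by
    have h1 : R * (a * a) = a * a * R := by
      have : Commute R a := by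
        have := cfc_commute_cfc (fun x : ℝ => √((|x| + η)⁻¹)) (fun x => x) a
        rwa [hid] at this
      exact (this.mul_right this).eq
    rw [mul_assoc, ← h1, ← mul_assoc, hRR]
  have hBB : star (C * R) * (C * R) = R * (a * a) * R := by
    rw [star_mul, hRs, haa]; simp only [mul_assoc]
  refine ⟨R, G, hRs, hGs, hRR, ?_, ?_, ?_⟩
  · rw [hBB, hRaR, hGa]
    have : a - η • 1 = cfc (fun x : ℝ => x - η) a := by
      rw [cfc_sub _ _ a (by fun_prop) (by fun_prop), hid, cfc_const η a,
        Algebra.algebraMap_eq_smul_one]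
    rw [this, cfc_le_iff _ _ a (by fun_prop) (by fun_prop (disch := exact hne _))]
    intro x hx
    have hx0 := hsp x hx
    rw [abs_of_nonneg hx0, inv_mul_eq_div, le_div_iff₀ (by positivity)]
    nlinarith
  · rw [hBB, hRaR, star_mul, hGs, haa, mul_assoc]
  · have : star (C * G) * (C * G) = cfc (fun x : ℝ => (|x| + η)⁻¹ * (x * x) * (|x| + η)⁻¹) a := by
      rw [cfc_mul _ _ a (by fun_prop (disch := exact hne _)) hc.continuousOn, ← hGa, star_mul, hGs,
        haa, ← hG]
      simp only [mul_assoc]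
    rw [this]
    refine cfc_le_one _ a fun x hx => ?_
    have hx0 := hsp x hx
    rw [abs_of_nonneg hx0, inv_mul_eq_div, ← div_eq_mul_inv, div_div, div_le_one (by positivity)]
    nlinarith

/-- The trace norm is bounded by any uniform bound on the partial traces of the operators
`(C R)† (C R) = (C G)† C` approximating `|C|`. -/
theorem traceNorm_le_of_approx (C : H →L[ℂ] H) {r : ℝ}
    (h : ∀ R G : H →L[ℂ] H, star R = R → star G = G → R * R = G →
      star (C * R) * (C * R) = star (C * G) * C → star (C * G) * (C * G) ≤ 1 →
      ∀ s : Finset (basisSet H),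
        ∑ i ∈ s, (⟪basis H i, (star (C * R) * (C * R)) (basis H i)⟫_ℂ).re ≤ r) :
    traceNorm C ≤ ENNReal.ofReal r := by
  refine posTrace_le_of_sum_le (CFC.abs_nonneg C) fun s => ?_
  refine le_of_forall_pos_le_add fun δ hδ => ?_
  -- The error is split over the vectors of `s`; the `+ 1` keeps it positive when `s` is empty.
  have hη : 0 < δ / (s.card + 1) := by positivity
  obtain ⟨R, G, hR, hG, hRG, h1, h2, h3⟩ := exists_approx_abs C hη
  have h4 := h R G hR hG hRG h2 h3 s
  have h5 : ∀ i, (⟪basis H i, CFC.abs C (basis H i)⟫_ℂ).re ≤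
      (⟪basis H i, (star (C * R) * (C * R)) (basis H i)⟫_ℂ).re + δ / (s.card + 1) := by
    intro i
    have := inner_re_mono h1 (basis H i)
    have e : ⟪basis H i, basis H i⟫_ℂ = 1 := by
      rw [inner_self_eq_norm_sq_to_K, (basis H).orthonormal.1 i]; simp
    have e2 : (⟪basis H i, (CFC.abs C - (δ / (s.card + 1)) • (1 : H →L[ℂ] H)) (basis H i)⟫_ℂ).re
        = (⟪basis H i, CFC.abs C (basis H i)⟫_ℂ).re - δ / (s.card + 1) := by
      rw [sub_apply, inner_sub_right, Complex.sub_re,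
        smul_apply, one_apply_eq_self, inner_smul_right_eq_smul, e,
        Complex.smul_re, Complex.one_re, smul_eq_mul, mul_one]
    rw [e2] at this
    linarith
  calc _ ≤ ∑ i ∈ s, ((⟪basis H i, (star (C * R) * (C * R)) (basis H i)⟫_ℂ).re
        + δ / (s.card + 1)) := Finset.sum_le_sum fun i _ => h5 i
    _ ≤ r + δ := by
      rw [Finset.sum_add_distrib, Finset.sum_const, nsmul_eq_mul]
      refine add_le_add h4 ?_
      rw [mul_div_assoc', div_le_iff₀ (by positivity)]
      nlinarith

/-- By cyclicity it suffices that `(C R)(C R)† ≤ |C†|`. The square of the left side is `C (C G)† (C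
G) C† ≤ C C†`, and the square root is operator monotone. -/
theorem traceNorm_le_traceNorm_star (C : H →L[ℂ] H) (h : traceNorm (star C) ≠ ∞) :
    traceNorm C ≤ traceNorm (star C) := by
  rw [← ENNReal.ofReal_toReal h]
  refine traceNorm_le_of_approx C fun R G hR hG hRG _ h3 s => ?_
  have h1 : posTrace (star (C * R) * (C * R)) ≤ traceNorm (star C) := by
    have e : posTrace (star (C * R) * (C * R)) = posTrace ((C * R) * star (C * R)) :=
      (posTrace_comp_adjoint (C * R)).symm
    rw [e]
    refine posTrace_mono ?_
    have hpos : 0 ≤ (C * R) * star (C * R) := mul_star_self_nonneg _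
    rw [← CFC.sqrt_mul_self _ hpos, CFC.abs, star_star]
    refine CFC.sqrt_le_sqrt _ _ ?_
    have e2 : (C * R) * star (C * R) = (C * G) * star C := by
      rw [star_mul, hR, ← hRG]; simp only [mul_assoc]
    have e3 : (C * R) * star (C * R) = C * star (C * G) := by
      rw [e2, star_mul, hG, mul_assoc]
    calc (C * R) * star (C * R) * ((C * R) * star (C * R))
        = C * (star (C * G) * (C * G)) * star C := by
          nth_rw 1 [e3]; rw [e2]; simp only [mul_assoc]
      _ ≤ C * 1 * star C := star_right_conjugate_le_conjugate h3 C
      _ = C * star C := by rw [mul_one]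
  refine (sum_inner_le_posTrace (star_mul_self_nonneg _) (ne_top_of_le_ne_top h h1) _ s).trans ?_
  exact ENNReal.toReal_mono h h1

/-- Cauchy–Schwarz for the Hilbert–Schmidt pairing of `A† V` and `B`, where the contraction `V` does
not increase the Hilbert–Schmidt norm of `A†`. -/
theorem traceNorm_mul_le (A B : H →L[ℂ] H) (hA : posTrace (A * star A) ≠ ∞)
    (hB : posTrace (star B * B) ≠ ∞) :
    traceNorm (A * B) ≤
      ENNReal.ofReal √((posTrace (A * star A)).toReal * (posTrace (star B * B)).toReal) := by
  refine traceNorm_le_of_approx _ fun R G hR hG hRG h2 h3 s => ?_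
  set V := A * B * G with hV
  have hW : posTrace (star (star A * V) * (star A * V)) ≤ posTrace (A * star A) := by
    have e : posTrace (star (star A * V) * (star A * V))
        = posTrace ((star A * V) * star (star A * V)) := (posTrace_comp_adjoint _).symm
    have e' : posTrace (A * star A) = posTrace (star A * A) := posTrace_comp_adjoint A
    rw [e, e']
    refine posTrace_mono ?_
    have h4 : V * star V ≤ 1 := by
      have h5 : ‖V‖ ≤ 1 := by
        have : ‖star V * V‖ ≤ 1 := (CStarAlgebra.norm_le_one_iff_of_nonneg _ (star_mul_self_nonneg V)).2 h3
        rw [CStarRing.norm_star_mul_self] at this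
        nlinarith [norm_nonneg V]
      refine (CStarAlgebra.norm_le_one_iff_of_nonneg _ (mul_star_self_nonneg V)).1 ?_
      rw [CStarRing.norm_self_mul_star]
      nlinarith [norm_nonneg V]
    calc star A * V * star (star A * V) = star A * (V * star V) * A := by
          rw [star_mul, star_star]; simp only [mul_assoc]
      _ ≤ star A * 1 * A := star_left_conjugate_le_conjugate h4 A
      _ = star A * A := by rw [mul_one]
  have hn : ∀ T : H →L[ℂ] H, ∀ x, (⟪x, (star T * T) x⟫_ℂ).re = ‖T x‖ ^ 2 := fun T x =>
    inner_adjoint_comp_self_re T x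
  have h6 : ∀ i, (⟪basis H i, (star (A * B * R) * (A * B * R)) (basis H i)⟫_ℂ).re
      ≤ ‖(star A * V) (basis H i)‖ * ‖B (basis H i)‖ := by
    intro i
    rw [h2]
    have : star V * (A * B) = star (star A * V) * B := by
      rw [star_mul (star A) V, star_star, mul_assoc]
    rw [this]
    refine (Complex.re_le_norm _).trans ?_
    rw [mul_apply_eq_comp, ContinuousLinearMap.star_eq_adjoint,
      ContinuousLinearMap.adjoint_inner_right]
    exact norm_inner_le_norm _ _
  refine (Finset.sum_le_sum fun i _ => h6 i).trans ?_
  refine Real.le_sqrt_of_sq_le ?_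
  refine (Finset.sum_mul_sq_le_sq_mul_sq s _ _).trans ?_
  refine mul_le_mul ?_ ?_ (by positivity) (by positivity)
  · rw [← Finset.sum_congr rfl fun i _ => hn (star A * V) (basis H i)]
    refine (sum_inner_le_posTrace (star_mul_self_nonneg (star A * V))
      (ne_top_of_le_ne_top hA hW) (basis H) s).trans ?_
    exact ENNReal.toReal_mono hA hW
  · rw [← Finset.sum_congr rfl fun i _ => hn B (basis H i)]
    exact sum_inner_le_posTrace (star_mul_self_nonneg B) hB (basis H) s

/-! ### Sums of positive operators -/

/-- Bounds the norm of `√T` by its Hilbert–Schmidt norm. It turns summability of traces into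
absolute convergence of the marginals. -/
theorem ofReal_norm_le_posTrace {T : H →L[ℂ] H} (hT : 0 ≤ T) :
    ENNReal.ofReal ‖T‖ ≤ posTrace T := by
  by_cases ht : posTrace T = ∞
  · simp [ht]
  rw [ENNReal.ofReal_le_iff_le_toReal ht]
  set S := CFC.sqrt T with hS
  have hSs : S.adjoint = S := (IsSelfAdjoint.of_nonneg (CFC.sqrt_nonneg T)).star_eq
  have hT' : S.adjoint ∘L S = T := by
    rw [hSs]; exact CFC.sqrt_mul_sqrt_self T hT
  have h1 : ∀ x, ‖S x‖ ^ 2 ≤ (posTrace T).toReal * ‖x‖ ^ 2 := by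
    intro x
    rw [← ENNReal.toReal_ofReal (sq_nonneg ‖x‖), ← ENNReal.toReal_mul,
      ← ENNReal.ofReal_le_iff_le_toReal (ENNReal.mul_ne_top ht ENNReal.ofReal_ne_top),
      ← parseval (basis H), ← hT', posTrace_adjoint_comp_self, ← ENNReal.tsum_mul_right]
    refine ENNReal.tsum_le_tsum fun i => ?_
    rw [← ENNReal.ofReal_mul (sq_nonneg _), ← ContinuousLinearMap.adjoint_inner_left, hSs,
      ← mul_pow]
    refine ENNReal.ofReal_le_ofReal ?_
    gcongr
    exact norm_inner_le_norm _ _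
  have h2 : ‖S‖ ≤ √(posTrace T).toReal := by
    refine S.opNorm_le_bound (Real.sqrt_nonneg _) fun x => ?_
    rw [← Real.sqrt_sq (norm_nonneg (S x)), ← Real.sqrt_sq (norm_nonneg x),
      ← Real.sqrt_mul ENNReal.toReal_nonneg]
    exact Real.sqrt_le_sqrt (h1 x)
  calc ‖T‖ = ‖S.adjoint ∘L S‖ := by rw [hT']
    _ = ‖S‖ * ‖S‖ := ContinuousLinearMap.norm_adjoint_comp_self S
    _ ≤ √(posTrace T).toReal * √(posTrace T).toReal := by gcongr
    _ = _ := Real.mul_self_sqrt ENNReal.toReal_nonneg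

theorem summable_of_tsum_posTrace_ne_top {ι : Type*} {T : ι → H →L[ℂ] H} (hT : ∀ i, 0 ≤ T i)
    (h : ∑' i, posTrace (T i) ≠ ∞) : Summable T := by
  refine Summable.of_norm_bounded (ENNReal.summable_toReal h) fun i => ?_
  rw [← ENNReal.ofReal_le_iff_le_toReal (ENNReal.ne_top_of_tsum_ne_top h i)]
  exact ofReal_norm_le_posTrace (hT i)

theorem posTrace_tsum {ι : Type*} {T : ι → H →L[ℂ] H} (hT : ∀ i, 0 ≤ T i) (hs : Summable T) :
    posTrace (∑' i, T i) = ∑' i, posTrace (T i) := by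
  simp only [posTrace]
  rw [ENNReal.tsum_comm]
  congr 1 with j
  have h : HasSum (fun i => (⟪basis H j, T i (basis H j)⟫_ℂ).re)
      (⟪basis H j, (∑' i, T i) (basis H j)⟫_ℂ).re :=
    Complex.hasSum_re ((innerSL ℂ (basis H j)).hasSum
      ((ContinuousLinearMap.apply ℂ H (basis H j)).hasSum hs.hasSum))
  rw [← h.tsum_eq, ENNReal.ofReal_tsum_of_nonneg (fun i => inner_re_nonneg (hT i) _) h.summable]

theorem eq_zero_of_inner_basis (w : H) (hw : ∀ i, ⟪w, basis H i⟫_ℂ = 0) : w = 0 := by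
  have h := parseval (basis H) w
  simp only [norm_inner_symm _ w, hw, norm_zero] at h
  simpa using h.symm

/-! ### Tensor products -/

theorem tensorRight_apply (x : H) (y : K) : tensorRight y x = tensorLeft x y := rfl

theorem inner_tensorLeft (x x' : H) (y y' : K) :
    ⟪tensorLeft x y, tensorLeft x' y'⟫_ℂ = ⟪x, x'⟫_ℂ * ⟪y, y'⟫_ℂ := by
  simp [tensorLeft]

theorem hTensor_ext {E : Type*} [NormedAddCommGroup E] [NormedSpace ℂ E]
    {f g : HTensor H K →L[ℂ] E} (h : ∀ x y, f (tensorLeft x y) = g (tensorLeft x y)) :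
    f = g := by
  ext z
  induction z using UniformSpace.Completion.induction_on with
  | hp => exact isClosed_eq f.continuous g.continuous
  | ih z =>
    induction z using TensorProduct.induction_on with
    | zero => rw [UniformSpace.Completion.coe_zero, map_zero, map_zero]
    | tmul x y => exact h x y
    | add a b ha hb => rw [UniformSpace.Completion.coe_add, map_add, map_add, ha, hb]

theorem tensorOp_tensorLeft (T : H →L[ℂ] H) (S : K →L[ℂ] K) (x : H) (y : K) :
    tensorOp T S (tensorLeft x y) = tensorLeft (T x) (S y) := by
  simp [tensorOp, tensorLeft]

theorem tensorOp_mul (T T' : H →L[ℂ] H) (S S' : K →L[ℂ] K) :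
    tensorOp (T * T') (S * S') = tensorOp T S * tensorOp T' S' :=
  hTensor_ext fun x y => by simp only [mul_apply_eq_comp, tensorOp_tensorLeft]

theorem tensorOp_add_right (T : H →L[ℂ] H) (S S' : K →L[ℂ] K) :
    tensorOp T (S + S') = tensorOp T S + tensorOp T S' :=
  hTensor_ext fun x y => by simp [tensorOp_tensorLeft]

theorem tensorOp_smul_right (c : ℝ) (T : H →L[ℂ] H) (S : K →L[ℂ] K) :
    tensorOp T (c • S) = c • tensorOp T S :=
  hTensor_ext fun x y => by
    change _ = c • tensorOp T S (tensorLeft x y)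
    rw [tensorOp_tensorLeft, tensorOp_tensorLeft]
    exact ((tensorLeft (T x)).restrictScalars ℝ).map_smul c (S y)

theorem tensorOp_adjoint (T : H →L[ℂ] H) (S : K →L[ℂ] K) :
    (tensorOp T S).adjoint = tensorOp T.adjoint S.adjoint := by
  refine hTensor_ext fun x y => ?_
  refine ext_inner_right ℂ fun z => ?_
  -- As functionals of `z` both sides are linear and continuous, so product vectors suffice again.
  suffices (innerSL ℂ ((tensorOp T S).adjoint (tensorLeft x y))) =
      innerSL ℂ (tensorOp T.adjoint S.adjoint (tensorLeft x y)) from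
    congrArg (fun f : HTensor H K →L[ℂ] ℂ => f z) this
  refine hTensor_ext fun x' y' => ?_
  simp [ContinuousLinearMap.adjoint_inner_left, tensorOp_tensorLeft, inner_tensorLeft]

theorem tensorOp_nonneg {T : H →L[ℂ] H} {S : K →L[ℂ] K} (hT : 0 ≤ T) (hS : 0 ≤ S) :
    0 ≤ tensorOp T S := by
  have h1 : star (CFC.sqrt T) = CFC.sqrt T := (IsSelfAdjoint.of_nonneg (CFC.sqrt_nonneg T)).star_eq
  have h2 : star (CFC.sqrt S) = CFC.sqrt S := (IsSelfAdjoint.of_nonneg (CFC.sqrt_nonneg S)).star_eq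
  rw [← CFC.sqrt_mul_sqrt_self T hT, ← CFC.sqrt_mul_sqrt_self S hS, tensorOp_mul]
  have h3 : star (tensorOp (CFC.sqrt T) (CFC.sqrt S)) = tensorOp (CFC.sqrt T) (CFC.sqrt S) := by
    rw [ContinuousLinearMap.star_eq_adjoint, tensorOp_adjoint, ← ContinuousLinearMap.star_eq_adjoint,
      ← ContinuousLinearMap.star_eq_adjoint, h1, h2]
  nth_rw 1 [← h3]
  exact star_mul_self_nonneg (tensorOp (CFC.sqrt T) (CFC.sqrt S))

theorem tensorOp_mono_right {T : H →L[ℂ] H} {S S' : K →L[ℂ] K} (hT : 0 ≤ T) (h : S ≤ S') :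
    tensorOp T S ≤ tensorOp T S' := by
  have := tensorOp_add_right T (S' - S) S
  rw [sub_add_cancel] at this
  rw [this]
  have h' := tensorOp_nonneg hT (sub_nonneg.2 h)
  exact le_add_of_nonneg_left h'

variable (H K) in
/-- The Hilbert basis `eᵢ ⊗ fⱼ` of the tensor product. -/
def tensorBasis : HilbertBasis (basisSet H × basisSet K) ℂ (HTensor H K) :=
  HilbertBasis.mkOfOrthogonalEqBot (v := fun p => tensorLeft (basis H p.1) (basis K p.2))
    (by
      classical
      rw [orthonormal_iff_ite]
      rintro ⟨i, j⟩ ⟨i', j'⟩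
      simp only [inner_tensorLeft, orthonormal_iff_ite.1 (basis H).orthonormal,
        orthonormal_iff_ite.1 (basis K).orthonormal, Prod.mk.injEq]
      split_ifs <;> simp_all)
    (by
      rw [Submodule.eq_bot_iff]
      intro z hz
      have h0 : ∀ i j, ⟪z, tensorLeft (basis H i) (basis K j)⟫_ℂ = 0 := fun i j =>
        (Submodule.mem_orthogonal' _ z).1 hz _ (Submodule.subset_span ⟨(i, j), rfl⟩)
      have h1 : ∀ i y, ⟪z, tensorLeft (basis H i) y⟫_ℂ = 0 := by
        intro i y
        rw [← ContinuousLinearMap.adjoint_inner_left,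
          eq_zero_of_inner_basis ((tensorLeft (basis H i)).adjoint z) fun j => by
            rw [ContinuousLinearMap.adjoint_inner_left, h0], inner_zero_left]
      have h2 : ∀ x y, ⟪z, tensorLeft x y⟫_ℂ = 0 := by
        intro x y
        rw [← tensorRight_apply, ← ContinuousLinearMap.adjoint_inner_left,
          eq_zero_of_inner_basis ((tensorRight y).adjoint z) fun j => by
            rw [ContinuousLinearMap.adjoint_inner_left, tensorRight_apply, h1], inner_zero_left]
      have h3 : innerSL ℂ z = 0 := hTensor_ext fun x y => by simpa using h2 x y
      have h4 : innerSL ℂ z z = 0 := by rw [h3]; rfl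
      exact inner_self_eq_zero.1 h4)

theorem tensorBasis_apply (i : basisSet H) (j : basisSet K) :
    tensorBasis H K (i, j) = tensorLeft (basis H i) (basis K j) := by
  simp [tensorBasis]

theorem posTrace_eq_tsum_tsum {ρ : HTensor H K →L[ℂ] HTensor H K} (hρ : 0 ≤ ρ) :
    posTrace ρ = ∑' i, ∑' j, ENNReal.ofReal
      (⟪tensorLeft (basis H i) (basis K j), ρ (tensorLeft (basis H i) (basis K j))⟫_ℂ).re := by
  rw [posTrace_eq hρ (tensorBasis H K), ENNReal.tsum_prod']
  simp only [tensorBasis_apply]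

theorem posTrace_tensorOp {T : H →L[ℂ] H} {S : K →L[ℂ] K} (hT : 0 ≤ T) (hS : 0 ≤ S) :
    posTrace (tensorOp T S) = posTrace T * posTrace S := by
  rw [posTrace_eq_tsum_tsum (tensorOp_nonneg hT hS), posTrace, ← ENNReal.tsum_mul_right]
  congr 1 with i
  rw [posTrace, ← ENNReal.tsum_mul_left]
  congr 1 with j
  have him : (⟪basis H i, T (basis H i)⟫_ℂ).im = 0 :=
    ((ContinuousLinearMap.nonneg_iff_isPositive T).1 hT).isSymmetric.im_inner_self_apply _
  rw [tensorOp_tensorLeft, inner_tensorLeft, Complex.mul_re, him, zero_mul, sub_zero,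
    ENNReal.ofReal_mul (inner_re_nonneg hT _)]

/-! ### Marginals -/

theorem tsum_posTrace_sliceB {ρ : HTensor H K →L[ℂ] HTensor H K} (hρ : 0 ≤ ρ) :
    ∑' i, posTrace ((tensorLeft (K := K) (basis H i)).adjoint ∘L ρ ∘L tensorLeft (basis H i)) =
      posTrace ρ := by
  rw [posTrace_eq_tsum_tsum hρ]
  simp only [posTrace, ContinuousLinearMap.comp_apply, ContinuousLinearMap.adjoint_inner_right]

theorem tsum_posTrace_sliceA {ρ : HTensor H K →L[ℂ] HTensor H K} (hρ : 0 ≤ ρ) :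
    ∑' j, posTrace ((tensorRight (H := H) (basis K j)).adjoint ∘L ρ ∘L tensorRight (basis K j)) =
      posTrace ρ := by
  rw [posTrace_eq_tsum_tsum hρ, ENNReal.tsum_comm]
  simp only [posTrace, ContinuousLinearMap.comp_apply, ContinuousLinearMap.adjoint_inner_right,
    tensorRight_apply]

theorem summable_sliceB {ρ : HTensor H K →L[ℂ] HTensor H K} (hρ : 0 ≤ ρ) (ht : posTrace ρ ≠ ∞) :
    Summable fun i => (tensorLeft (K := K) (basis H i)).adjoint ∘L ρ ∘L tensorLeft (basis H i) :=
  summable_of_tsum_posTrace_ne_top (fun _ => adjoint_conj_nonneg hρ _)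
    (by rwa [tsum_posTrace_sliceB hρ])

theorem summable_sliceA {ρ : HTensor H K →L[ℂ] HTensor H K} (hρ : 0 ≤ ρ) (ht : posTrace ρ ≠ ∞) :
    Summable fun j => (tensorRight (H := H) (basis K j)).adjoint ∘L ρ ∘L tensorRight (basis K j) :=
  summable_of_tsum_posTrace_ne_top (fun _ => adjoint_conj_nonneg hρ _)
    (by rwa [tsum_posTrace_sliceA hρ])

/-- Finite trace is not needed: a divergent series has the value `0`. -/
theorem marginalA_nonneg {ρ : HTensor H K →L[ℂ] HTensor H K} (hρ : 0 ≤ ρ) : 0 ≤ marginalA ρ :=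
  tsum_nonneg fun _ => adjoint_conj_nonneg hρ _

theorem marginalB_nonneg {ρ : HTensor H K →L[ℂ] HTensor H K} (hρ : 0 ≤ ρ) : 0 ≤ marginalB ρ :=
  tsum_nonneg fun _ => adjoint_conj_nonneg hρ _

theorem posTrace_marginalA {ρ : HTensor H K →L[ℂ] HTensor H K} (hρ : 0 ≤ ρ)
    (ht : posTrace ρ ≠ ∞) : posTrace (marginalA ρ) = posTrace ρ := by
  rw [marginalA, posTrace_tsum (fun _ => adjoint_conj_nonneg hρ _) (summable_sliceA hρ ht),
    tsum_posTrace_sliceA hρ]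

theorem posTrace_marginalB {ρ : HTensor H K →L[ℂ] HTensor H K} (hρ : 0 ≤ ρ)
    (ht : posTrace ρ ≠ ∞) : posTrace (marginalB ρ) = posTrace ρ := by
  rw [marginalB, posTrace_tsum (fun _ => adjoint_conj_nonneg hρ _) (summable_sliceB hρ ht),
    tsum_posTrace_sliceB hρ]

theorem IsState.marginalA {ρ : HTensor H K →L[ℂ] HTensor H K} (hρ : IsState ρ) :
    IsState (marginalA ρ) :=
  ⟨marginalA_nonneg hρ.1, by rw [posTrace_marginalA hρ.1 (by simp [hρ.2]), hρ.2]⟩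

theorem IsState.marginalB {ρ : HTensor H K →L[ℂ] HTensor H K} (hρ : IsState ρ) :
    IsState (marginalB ρ) :=
  ⟨marginalB_nonneg hρ.1, by rw [posTrace_marginalB hρ.1 (by simp [hρ.2]), hρ.2]⟩

theorem IsState.tensorOp {T : H →L[ℂ] H} {S : K →L[ℂ] K} (hT : IsState T) (hS : IsState S) :
    IsState (tensorOp T S) :=
  ⟨tensorOp_nonneg hT.1 hS.1, by rw [posTrace_tensorOp hT.1 hS.1, hT.2, hS.2, one_mul]⟩

theorem marginalB_smul (c : ℝ) (ρ : HTensor H K →L[ℂ] HTensor H K) :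
    marginalB (c • ρ) = c • marginalB ρ := by
  rw [marginalB, marginalB, ← tsum_const_smul'']
  congr 1 with i
  simp

theorem marginalB_add {ρ σ : HTensor H K →L[ℂ] HTensor H K} (hρ : 0 ≤ ρ) (hρt : posTrace ρ ≠ ∞)
    (hσ : 0 ≤ σ) (hσt : posTrace σ ≠ ∞) :
    marginalB (ρ + σ) = marginalB ρ + marginalB σ := by
  rw [marginalB, marginalB, marginalB,
    ← (summable_sliceB hρ hρt).tsum_add (summable_sliceB hσ hσt)]
  congr 1 with i
  simp

theorem marginalB_tensorOp {T : H →L[ℂ] H} (hT : IsState T) (S : K →L[ℂ] K) :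
    marginalB (tensorOp T S) = S := by
  have hsl : ∀ i, (tensorLeft (K := K) (basis H i)).adjoint ∘L tensorOp T S ∘L
      tensorLeft (basis H i) = (⟪basis H i, T (basis H i)⟫_ℂ).re • S := by
    intro i
    ext y
    refine ext_inner_left ℂ fun z => ?_
    have him : ⟪basis H i, T (basis H i)⟫_ℂ = ((⟪basis H i, T (basis H i)⟫_ℂ).re : ℂ) :=
      (((ContinuousLinearMap.nonneg_iff_isPositive T).1
        hT.1).isSymmetric.coe_re_inner_self_apply _).symm
    rw [ContinuousLinearMap.comp_apply, ContinuousLinearMap.comp_apply,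
      ContinuousLinearMap.adjoint_inner_right, tensorOp_tensorLeft, inner_tensorLeft, him,
      smul_apply, inner_smul_right_eq_smul, Complex.real_smul]
    simp
  have hs : Summable fun i => (⟪basis H i, T (basis H i)⟫_ℂ).re := by
    have := ENNReal.summable_toReal (f := fun i => ENNReal.ofReal (⟪basis H i, T (basis H i)⟫_ℂ).re)
      (by change posTrace T ≠ ∞; simp [hT.2])
    simpa only [ENNReal.toReal_ofReal (inner_re_nonneg hT.1 _)] using this
  have h1 : ∑' i, (⟪basis H i, T (basis H i)⟫_ℂ).re = 1 := by
    have h2 : ENNReal.ofReal (∑' i, (⟪basis H i, T (basis H i)⟫_ℂ).re) = 1 := by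
      rw [ENNReal.ofReal_tsum_of_nonneg (fun i => inner_re_nonneg hT.1 _) hs]
      exact hT.2
    exact ENNReal.ofReal_eq_one.1 h2
  simp only [marginalB, hsl]
  rw [hs.tsum_smul_const, h1, one_smul]

/-! ### Fidelity of normalized operators -/

variable (H K) in
/-- The inclusion of the first summand in the Hilbert space direct sum. -/
def inlL : H →L[ℂ] WithLp 2 (H × K) :=
  ((WithLp.prodContinuousLinearEquiv 2 ℂ H K).symm : (H × K) →L[ℂ] WithLp 2 (H × K)) ∘L
    ContinuousLinearMap.inl ℂ H K

variable (H K) in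
/-- The inclusion of the second summand in the Hilbert space direct sum. -/
def inrL : K →L[ℂ] WithLp 2 (H × K) :=
  ((WithLp.prodContinuousLinearEquiv 2 ℂ H K).symm : (H × K) →L[ℂ] WithLp 2 (H × K)) ∘L
    ContinuousLinearMap.inr ℂ H K

theorem inlL_adjoint_apply (z : WithLp 2 (H × K)) : (inlL H K).adjoint z = z.fst := by
  refine ext_inner_right ℂ fun x => ?_
  rw [ContinuousLinearMap.adjoint_inner_left]
  simp [inlL]

theorem inrL_adjoint_apply (z : WithLp 2 (H × K)) : (inrL H K).adjoint z = z.snd := by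
  refine ext_inner_right ℂ fun x => ?_
  rw [ContinuousLinearMap.adjoint_inner_left]
  simp [inrL]

theorem inlL_adjoint_comp_inlL : (inlL H K).adjoint ∘L inlL H K = 1 := by
  ext x
  rw [ContinuousLinearMap.comp_apply, inlL_adjoint_apply]
  simp [inlL]

theorem inlL_adjoint_inrL (y : K) : (inlL H K).adjoint (inrL H K y) = 0 := by
  rw [inlL_adjoint_apply]
  simp [inrL]

theorem inlL_adjoint_inlL (x : H) : (inlL H K).adjoint (inlL H K x) = x := by
  rw [inlL_adjoint_apply]
  simp [inlL]

theorem directSum_eq (T : H →L[ℂ] H) (S : K →L[ℂ] K) :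
    directSum T S = inlL H K ∘L T ∘L (inlL H K).adjoint +
      inrL H K ∘L S ∘L (inrL H K).adjoint := by
  ext z
  simp only [add_apply, ContinuousLinearMap.comp_apply, inlL_adjoint_apply, inrL_adjoint_apply]
  simp [directSum, inlL, inrL, ← WithLp.toLp_add, Prod.map]

theorem IsSubstate.normalize_nonneg {ρ : H →L[ℂ] H} (hρ : IsSubstate ρ) : 0 ≤ normalize ρ := by
  rw [normalize, directSum_eq]
  have h1 : (posTrace ρ).toReal ≤ 1 := ENNReal.toReal_le_of_le_ofReal one_pos.le
    (by simpa using hρ.trace_le_one)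
  have h2 : (0 : ℂ →L[ℂ] ℂ) ≤ ContinuousLinearMap.id ℂ ℂ :=
    (ContinuousLinearMap.nonneg_iff_isPositive _).2 ContinuousLinearMap.isPositive_id
  exact add_nonneg (conj_nonneg hρ.nonneg _) (conj_nonneg (smul_nonneg (sub_nonneg.2 h1) h2) _)

theorem IsState.isSubstate {ρ : H →L[ℂ] H} (hρ : IsState ρ) : IsSubstate ρ :=
  ⟨hρ.1, hρ.2.le⟩

theorem IsState.normalize_eq {ρ : H →L[ℂ] H} (hρ : IsState ρ) :
    normalize ρ = inlL H ℂ ∘L ρ ∘L (inlL H ℂ).adjoint := by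
  rw [normalize, directSum_eq, hρ.2]
  simp

theorem compress_normalize (ρ : H →L[ℂ] H) :
    (inlL H ℂ).adjoint ∘L normalize ρ ∘L inlL H ℂ = ρ := by
  rw [normalize, directSum_eq]
  ext x
  simp [inlL_adjoint_inlL, inlL_adjoint_inrL]

/-! ### Conjugation by isometries, and monotonicity, scaling and symmetry of the fidelity. -/

theorem isometry_conj_mul (J : H →L[ℂ] K) (hJ : J.adjoint ∘L J = 1) (S T : H →L[ℂ] H) :
    (J ∘L S ∘L J.adjoint) * (J ∘L T ∘L J.adjoint) = J ∘L (S * T) ∘L J.adjoint := by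
  ext x
  have : ∀ y, J.adjoint (J y) = y := fun y => congrArg (fun f : H →L[ℂ] H => f y) hJ
  simp [mul_apply_eq_comp, this]

theorem sqrt_isometry_conj (J : H →L[ℂ] K) (hJ : J.adjoint ∘L J = 1) {T : H →L[ℂ] H}
    (hT : 0 ≤ T) :
    CFC.sqrt (J ∘L T ∘L J.adjoint) = J ∘L CFC.sqrt T ∘L J.adjoint := by
  refine CFC.sqrt_unique ?_ (conj_nonneg (CFC.sqrt_nonneg T) J)
  rw [isometry_conj_mul J hJ, CFC.sqrt_mul_sqrt_self T hT]

theorem posTrace_isometry_conj (J : H →L[ℂ] K) (hJ : J.adjoint ∘L J = 1) {T : H →L[ℂ] H}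
    (hT : 0 ≤ T) : posTrace (J ∘L T ∘L J.adjoint) = posTrace T := by
  have hs : (CFC.sqrt T).adjoint = CFC.sqrt T :=
    (IsSelfAdjoint.of_nonneg (CFC.sqrt_nonneg T)).star_eq
  have hsq : CFC.sqrt T ∘L CFC.sqrt T = T := CFC.sqrt_mul_sqrt_self T hT
  have h1 : J ∘L T ∘L J.adjoint = (J ∘L CFC.sqrt T) ∘L (J ∘L CFC.sqrt T).adjoint := by
    rw [ContinuousLinearMap.adjoint_comp, hs]
    nth_rw 1 [← hsq]
    rfl
  have h2 : (J ∘L CFC.sqrt T).adjoint ∘L (J ∘L CFC.sqrt T) = T := by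
    rw [ContinuousLinearMap.adjoint_comp, hs]
    calc _ = CFC.sqrt T ∘L (J.adjoint ∘L J) ∘L CFC.sqrt T := rfl
      _ = T := by rw [hJ]; exact hsq
  rw [h1, posTrace_comp_adjoint, h2]

/-- The trace norm `‖√ρ √σ‖₁ = Tr √(√σ ρ √σ)`. -/
theorem traceNorm_sqrt_mul_sqrt {ρ : H →L[ℂ] H} (hρ : 0 ≤ ρ) (σ : H →L[ℂ] H) :
    traceNorm (CFC.sqrt ρ * CFC.sqrt σ) =
      posTrace (CFC.sqrt (CFC.sqrt σ * ρ * CFC.sqrt σ)) := by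
  have h1 : star (CFC.sqrt ρ) = CFC.sqrt ρ := (IsSelfAdjoint.of_nonneg (CFC.sqrt_nonneg ρ)).star_eq
  have h2 : star (CFC.sqrt σ) = CFC.sqrt σ := (IsSelfAdjoint.of_nonneg (CFC.sqrt_nonneg σ)).star_eq
  rw [traceNorm, CFC.abs, star_mul, h1, h2]
  have h3 : CFC.sqrt σ * CFC.sqrt ρ * (CFC.sqrt ρ * CFC.sqrt σ) =
      CFC.sqrt σ * (CFC.sqrt ρ * CFC.sqrt ρ) * CFC.sqrt σ := by simp only [mul_assoc]
  rw [h3, CFC.sqrt_mul_sqrt_self ρ hρ]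

theorem star_sqrt_mul_sqrt (ρ σ : H →L[ℂ] H) :
    star (CFC.sqrt ρ * CFC.sqrt σ) = CFC.sqrt σ * CFC.sqrt ρ := by
  rw [star_mul, (IsSelfAdjoint.of_nonneg (CFC.sqrt_nonneg ρ)).star_eq,
    (IsSelfAdjoint.of_nonneg (CFC.sqrt_nonneg σ)).star_eq]

theorem traceNorm_sqrt_mul_sqrt_le {ρ σ : H →L[ℂ] H} (hρ : 0 ≤ ρ) (hσ : 0 ≤ σ)
    (hρt : posTrace ρ ≠ ∞) (hσt : posTrace σ ≠ ∞) :
    traceNorm (CFC.sqrt ρ * CFC.sqrt σ) ≤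
      ENNReal.ofReal √((posTrace ρ).toReal * (posTrace σ).toReal) := by
  have h1 : CFC.sqrt ρ * star (CFC.sqrt ρ) = ρ := by
    rw [(IsSelfAdjoint.of_nonneg (CFC.sqrt_nonneg ρ)).star_eq, CFC.sqrt_mul_sqrt_self ρ hρ]
  have h2 : star (CFC.sqrt σ) * CFC.sqrt σ = σ := by
    rw [(IsSelfAdjoint.of_nonneg (CFC.sqrt_nonneg σ)).star_eq, CFC.sqrt_mul_sqrt_self σ hσ]
  have := traceNorm_mul_le (CFC.sqrt ρ) (CFC.sqrt σ) (by rwa [h1]) (by rwa [h2])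
  rwa [h1, h2] at this

/-- In the form `Tr √(√σ ρ √σ)` the operator `ρ` enters linearly under an operator monotone square
root. -/
theorem traceNorm_sqrt_mul_sqrt_mono {ρ ρ' : H →L[ℂ] H} (hρ : 0 ≤ ρ) (h : ρ ≤ ρ')
    (σ : H →L[ℂ] H) :
    traceNorm (CFC.sqrt ρ * CFC.sqrt σ) ≤ traceNorm (CFC.sqrt ρ' * CFC.sqrt σ) := by
  rw [traceNorm_sqrt_mul_sqrt hρ, traceNorm_sqrt_mul_sqrt (hρ.trans h)]
  refine posTrace_mono (CFC.sqrt_le_sqrt _ _ ?_)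
  have := star_right_conjugate_le_conjugate h (CFC.sqrt σ)
  rwa [(IsSelfAdjoint.of_nonneg (CFC.sqrt_nonneg σ)).star_eq] at this

theorem traceNorm_sqrt_smul_mul_sqrt {c : ℝ} (hc : 0 ≤ c) {ρ : H →L[ℂ] H} (hρ : 0 ≤ ρ)
    (σ : H →L[ℂ] H) :
    traceNorm (CFC.sqrt (c • ρ) * CFC.sqrt σ) =
      ENNReal.ofReal √c * traceNorm (CFC.sqrt ρ * CFC.sqrt σ) := by
  rw [traceNorm_sqrt_mul_sqrt hρ, traceNorm_sqrt_mul_sqrt (smul_nonneg hc hρ),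
    ← posTrace_smul (Real.sqrt_nonneg c), ← sqrt_smul hc, mul_smul_comm, smul_mul_assoc]
  have := star_right_conjugate_nonneg hρ (CFC.sqrt σ)
  rwa [(IsSelfAdjoint.of_nonneg (CFC.sqrt_nonneg σ)).star_eq] at this

theorem traceNorm_sqrt_mul_sqrt_ne_top {ρ σ : H →L[ℂ] H} (hρ : IsSubstate ρ)
    (hσ : IsSubstate σ) : traceNorm (CFC.sqrt ρ * CFC.sqrt σ) ≠ ∞ :=
  ne_top_of_le_ne_top ENNReal.ofReal_ne_top (traceNorm_sqrt_mul_sqrt_le hρ.nonneg hσ.nonneg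
    (ne_top_of_le_ne_top ENNReal.one_ne_top hρ.trace_le_one)
    (ne_top_of_le_ne_top ENNReal.one_ne_top hσ.trace_le_one))

/-- The fidelity with an operator supported on a subspace only depends on the compression to this
subspace. -/
theorem traceNorm_sqrt_mul_sqrt_isometry_conj (J : H →L[ℂ] K) (hJ : J.adjoint ∘L J = 1)
    {P : K →L[ℂ] K} (hP : 0 ≤ P) {σ : H →L[ℂ] H} (hσ : 0 ≤ σ) :
    traceNorm (CFC.sqrt P * CFC.sqrt (J ∘L σ ∘L J.adjoint)) =
      traceNorm (CFC.sqrt (J.adjoint ∘L P ∘L J) * CFC.sqrt σ) := by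
  have hP' := adjoint_conj_nonneg hP J
  have hpos : 0 ≤ CFC.sqrt σ * (J.adjoint ∘L P ∘L J) * CFC.sqrt σ := by
    have := star_right_conjugate_nonneg hP' (CFC.sqrt σ)
    rwa [(IsSelfAdjoint.of_nonneg (CFC.sqrt_nonneg σ)).star_eq] at this
  have h : (J ∘L CFC.sqrt σ ∘L J.adjoint) * P * (J ∘L CFC.sqrt σ ∘L J.adjoint) =
      J ∘L (CFC.sqrt σ * (J.adjoint ∘L P ∘L J) * CFC.sqrt σ) ∘L J.adjoint := rfl
  rw [traceNorm_sqrt_mul_sqrt hP, traceNorm_sqrt_mul_sqrt hP', sqrt_isometry_conj J hJ hσ, h,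
    sqrt_isometry_conj J hJ hpos, posTrace_isometry_conj J hJ (CFC.sqrt_nonneg _)]

/-- Finiteness matters because `toReal` sends `∞` to `0`. -/
theorem fidelity_le_fidelity_swap {ρ σ : H →L[ℂ] H}
    (h : traceNorm (CFC.sqrt σ * CFC.sqrt ρ) ≠ ∞) : fidelity ρ σ ≤ fidelity σ ρ := by
  have h1 := traceNorm_le_traceNorm_star (CFC.sqrt ρ * CFC.sqrt σ) (by rwa [star_sqrt_mul_sqrt])
  rw [star_sqrt_mul_sqrt] at h1
  have h2 := ENNReal.toReal_mono h h1
  rw [fidelity, fidelity]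
  gcongr

theorem fidelity_isometry_conj (J : H →L[ℂ] K) (hJ : J.adjoint ∘L J = 1)
    {P : K →L[ℂ] K} (hP : 0 ≤ P) {σ : H →L[ℂ] H} (hσ : 0 ≤ σ) :
    fidelity P (J ∘L σ ∘L J.adjoint) = fidelity (J.adjoint ∘L P ∘L J) σ := by
  rw [fidelity, fidelity, traceNorm_sqrt_mul_sqrt_isometry_conj J hJ hP hσ]

theorem fidelity_isometry_conj_left_le (J : H →L[ℂ] K) (hJ : J.adjoint ∘L J = 1)
    {P : K →L[ℂ] K} (hP : 0 ≤ P) {σ : H →L[ℂ] H} (hσ : IsSubstate σ)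
    (h : IsSubstate (J.adjoint ∘L P ∘L J)) :
    fidelity (J ∘L σ ∘L J.adjoint) P ≤ fidelity (J.adjoint ∘L P ∘L J) σ := by
  rw [← fidelity_isometry_conj J hJ hP hσ.nonneg]
  refine fidelity_le_fidelity_swap ?_
  rw [traceNorm_sqrt_mul_sqrt_isometry_conj J hJ hP hσ.nonneg]
  exact traceNorm_sqrt_mul_sqrt_ne_top h hσ

/-- If one of the two operators is a state, then normalizing does not change the fidelity. -/
theorem fidelity_normalize {ρ σ : H →L[ℂ] H} (hρ : IsSubstate ρ) (hσ : IsState σ) :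
    fidelity (normalize ρ) (normalize σ) = fidelity ρ σ := by
  rw [hσ.normalize_eq, fidelity_isometry_conj _ inlL_adjoint_comp_inlL hρ.normalize_nonneg
    hσ.nonneg, compress_normalize]

/-- Needed because `smoothDMax` puts the given state first in the purified distance and
`altSmoothIMax` puts it second. -/
theorem fidelity_normalize_swap_le {ρ σ : H →L[ℂ] H} (hρ : IsSubstate ρ) (hσ : IsState σ) :
    fidelity (normalize σ) (normalize ρ) ≤ fidelity ρ σ := by
  have h := fidelity_isometry_conj_left_le (inlL H ℂ) inlL_adjoint_comp_inlL
    hρ.normalize_nonneg hσ.isSubstate (by rwa [compress_normalize])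
  rwa [← hσ.normalize_eq, compress_normalize] at h

theorem purifiedDist_le_of_le_fidelity {ρ σ : H →L[ℂ] H} (hρ : IsSubstate ρ) (hσ : IsState σ)
    {ε : ℝ} (hε : 0 ≤ ε) (h : 1 - ε ^ 2 ≤ fidelity ρ σ) : purifiedDist ρ σ ≤ ε := by
  rw [purifiedDist, sineDist, Real.sqrt_le_left hε, fidelity_normalize hρ hσ]
  linarith

theorem le_fidelity_of_purifiedDist_le {ρ σ : H →L[ℂ] H} (hρ : IsSubstate ρ) (hσ : IsState σ)
    {ε : ℝ} (hε : 0 ≤ ε) (h : purifiedDist σ ρ ≤ ε) : 1 - ε ^ 2 ≤ fidelity ρ σ := by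
  rw [purifiedDist, sineDist, Real.sqrt_le_left hε] at h
  linarith [fidelity_normalize_swap_le hρ hσ]

/-! ### The main estimate -/

/-- Closeness to a state forces a large trace; this keeps `L` away from zero in `exists_state_mix`.
-/
theorem fidelity_le_posTrace {ρ σ : H →L[ℂ] H} (hρ : IsSubstate ρ) (hσ : IsState σ) :
    fidelity ρ σ ≤ (posTrace ρ).toReal := by
  have h := traceNorm_sqrt_mul_sqrt_le hρ.nonneg hσ.nonneg
    (ne_top_of_le_ne_top ENNReal.one_ne_top hρ.trace_le_one) (by simp [hσ.trace_eq_one])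
  rw [hσ.trace_eq_one, ENNReal.toReal_one, mul_one] at h
  have h2 := ENNReal.toReal_le_of_le_ofReal (Real.sqrt_nonneg _) h
  rw [fidelity]
  calc _ ≤ √(posTrace ρ).toReal ^ 2 := by gcongr
    _ = _ := Real.sq_sqrt ENNReal.toReal_nonneg

theorem mul_fidelity_le_of_smul_le {c : ℝ} (hc : 0 ≤ c) {ρ ρ' σ : H →L[ℂ] H}
    (hρ : 0 ≤ ρ) (hρ' : IsState ρ') (hσ : IsState σ) (h : c • ρ ≤ ρ') :
    c * fidelity ρ σ ≤ fidelity ρ' σ := by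
  have hfin := traceNorm_sqrt_mul_sqrt_ne_top hρ'.isSubstate hσ.isSubstate
  have h1 := traceNorm_sqrt_mul_sqrt_mono (smul_nonneg hc hρ) h σ
  rw [traceNorm_sqrt_smul_mul_sqrt hc hρ] at h1
  have h2 := ENNReal.toReal_mono hfin h1
  rw [ENNReal.toReal_mul, ENNReal.toReal_ofReal (Real.sqrt_nonneg c)] at h2
  rw [fidelity, fidelity]
  calc c * (traceNorm (CFC.sqrt ρ * CFC.sqrt σ)).toReal ^ 2
      = (√c * (traceNorm (CFC.sqrt ρ * CFC.sqrt σ)).toReal) ^ 2 := by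
        rw [mul_pow, Real.sq_sqrt hc]
    _ ≤ _ := by gcongr

/-- Mixing a subnormalized state `ω ≤ L τ` with the state `τ`. -/
theorem exists_state_mix {θ τ ω : H →L[ℂ] H} (hθ : IsState θ) (hτ : IsState τ)
    (hω : IsSubstate ω) {ε γ L : ℝ} (hε : ε < 1) (hγ : 0 < γ) (hγε : γ < ε) (hL : 0 < L)
    (hle : ω ≤ L • τ) (hP : purifiedDist θ ω ≤ ε - γ) :
    ∃ c t : ℝ, 0 ≤ c ∧ 0 ≤ t ∧ IsState (c • ω + t • τ) ∧ purifiedDist (c • ω + t • τ) θ ≤ ε ∧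
      ∀ X, t • τ ≤ X → c • ω + t • τ ≤ (L * (3 / γ ^ 2)) • X := by
  have hωt : posTrace ω ≠ ∞ := ne_top_of_le_ne_top ENNReal.one_ne_top hω.trace_le_one
  have hF := le_fidelity_of_purifiedDist_le hω hθ (sub_nonneg.2 hγε.le) hP
  have hFp := fidelity_le_posTrace hω hθ
  have hp0 : 0 ≤ (posTrace ω).toReal := ENNReal.toReal_nonneg
  have hωp : posTrace ω = ENNReal.ofReal (posTrace ω).toReal := (ENNReal.ofReal_toReal hωt).symm
  have hp1 : (posTrace ω).toReal ≤ 1 :=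
    ENNReal.toReal_le_of_le_ofReal one_pos.le (by simpa using hω.trace_le_one)
  have hpL : (posTrace ω).toReal ≤ L := by
    have := posTrace_mono hle
    rw [posTrace_smul hL.le, hτ.trace_eq_one, mul_one] at this
    exact ENNReal.toReal_le_of_le_ofReal hL.le this
  generalize (posTrace ω).toReal = p at hFp hp0 hωp hp1 hpL
  -- `L ≥ p ≥ 1 - (ε - γ)² ≥ 1 - (ε - γ) ≥ γ`, using `ε < 1`.
  have hγL : γ ≤ L := by nlinarith
  obtain ⟨c, hc⟩ : ∃ c, c = 1 - γ ^ 2 := ⟨_, rfl⟩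
  have hc0 : 0 ≤ c := by nlinarith
  -- The weight that restores trace one; `p ≤ 1` gives `t ≥ 1 - c = γ²`.
  obtain ⟨t, ht⟩ : ∃ t, t = 1 - c * p := ⟨_, rfl⟩
  have htγ : γ ^ 2 ≤ t := by nlinarith
  have ht0 : 0 < t := lt_of_lt_of_le (by positivity) htγ
  have hcω : 0 ≤ c • ω := smul_nonneg hc0 hω.nonneg
  have htτ : 0 ≤ t • τ := smul_nonneg ht0.le hτ.nonneg
  have hs : IsState (c • ω + t • τ) := by
    refine ⟨add_nonneg hcω htτ, ?_⟩
    rw [posTrace_add hcω htτ, posTrace_smul hc0, posTrace_smul ht0.le, hτ.trace_eq_one, mul_one,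
      hωp, ← ENNReal.ofReal_mul hc0, ← ENNReal.ofReal_add (by positivity) ht0.le, ht]
    simp
  refine ⟨c, t, hc0, ht0.le, hs, ?_, fun X hX => ?_⟩
  · refine purifiedDist_le_of_le_fidelity hs.isSubstate hθ (by linarith) ?_
    have h1 := mul_fidelity_le_of_smul_le hc0 hω.nonneg hs hθ (le_add_of_nonneg_right htτ)
    have h2 : c * (1 - (ε - γ) ^ 2) ≤ c * fidelity ω θ := by gcongr
    -- Rests on `γ² + (ε - γ)² ≤ ε²`, whose defect is `2 γ (ε - γ)`.
    have h3 : 1 - ε ^ 2 ≤ c * (1 - (ε - γ) ^ 2) := by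
      rw [hc]
      nlinarith [mul_nonneg hγ.le (sub_nonneg.2 hγε.le), sq_nonneg (γ * (ε - γ))]
    linarith
  -- The difference of the two sides is increasing in `t`, so `t = γ²` is the worst case; there `3
  -- L` exceeds `c L + γ²` since `γ² ≤ L`.
  · have hk : c * L + t ≤ L * (3 / γ ^ 2) * t := by
      have h3 : 3 / γ ^ 2 * γ ^ 2 = 3 := div_mul_cancel₀ _ (by positivity)
      have h4 : γ ^ 2 ≤ L := by nlinarith
      have h5 : 1 ≤ L * (3 / γ ^ 2) := by
        rw [mul_div_assoc', le_div_iff₀ (by positivity)]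
        linarith
      have h6 := mul_nonneg (sub_nonneg.2 h5) (sub_nonneg.2 htγ)
      have h7 : L * (3 / γ ^ 2) * γ ^ 2 = L * 3 := by rw [mul_assoc, h3]
      have h8 : 0 < γ ^ 2 * L := by positivity
      rw [hc]
      linarith
    calc c • ω + t • τ ≤ c • (L • τ) + t • τ :=
          add_le_add_left (smul_le_smul_of_nonneg_left hle hc0) _
      _ = (c * L + t) • τ := by rw [smul_smul, add_smul]
      _ ≤ (L * (3 / γ ^ 2) * t) • τ := smul_le_smul_of_nonneg_right hk hτ.nonneg
      _ = (L * (3 / γ ^ 2)) • (t • τ) := (smul_smul _ _ _).symm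
      _ ≤ _ := smul_le_smul_of_nonneg_left hX (by positivity)

set_option maxHeartbeats 1000000 in
-- The product part contributes exactly `t θ_B`, as `θ_A` has trace one, and the part from `ω` is
-- positive.
theorem smul_marginalB_le_marginalB_mix {θ ω : HTensor H K →L[ℂ] HTensor H K}
    (hθ : IsState θ) (hω : IsSubstate ω) {c t : ℝ} (hc : 0 ≤ c) (ht : 0 ≤ t) :
    t • marginalB θ ≤ marginalB (c • ω + t • tensorOp (marginalA θ) (marginalB θ)) := by
  have hτ := hθ.marginalA.tensorOp hθ.marginalB
  have hωt : posTrace ω ≠ ∞ := ne_top_of_le_ne_top ENNReal.one_ne_top hω.trace_le_one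
  rw [marginalB_add (smul_operator_nonneg hc hω.nonneg)
    (by rw [posTrace_smul hc]; exact ENNReal.mul_ne_top ENNReal.ofReal_ne_top hωt)
    (smul_operator_nonneg ht hτ.nonneg) (by rw [posTrace_smul ht, hτ.trace_eq_one]; simp),
    marginalB_smul, marginalB_smul, marginalB_tensorOp hθ.marginalA]
  exact le_add_of_nonneg_left (smul_operator_nonneg hc (marginalB_nonneg hω.nonneg))

set_option maxHeartbeats 1000000 in
theorem exists_state_le_tensorOp_marginalB {θ ω : HTensor H K →L[ℂ] HTensor H K}
    (hθ : IsState θ) (hω : IsSubstate ω) {ε γ l : ℝ} (hε : ε < 1) (hγ : 0 < γ) (hγε : γ < ε)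
    (hle : ω ≤ ((2 : ℝ) ^ l) • tensorOp (marginalA θ) (marginalB θ))
    (hP : purifiedDist θ ω ≤ ε - γ) :
    ∃ θ' : HTensor H K →L[ℂ] HTensor H K, IsState θ' ∧ purifiedDist θ' θ ≤ ε ∧
      θ' ≤ ((2 : ℝ) ^ l * (3 / γ ^ 2)) • tensorOp (marginalA θ) (marginalB θ') := by
  have hL : 0 < (2 : ℝ) ^ l := Real.rpow_pos_of_pos two_pos l
  obtain ⟨c, t, hc, ht, hs, hd, hm⟩ := exists_state_mix hθ
    (hθ.marginalA.tensorOp hθ.marginalB) hω hε hγ hγε hL hle hP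
  -- The operator `X` of `exists_state_mix` is taken to be `θ_A ⊗ θ'_B`.
  refine ⟨_, hs, hd, hm _ (le_of_eq_of_le (tensorOp_smul_right t _ _).symm ?_)⟩
  exact tensorOp_mono_right hθ.marginalA.nonneg (smul_marginalB_le_marginalB_mix hθ hω hc ht)

end QIT

end

theorem mainTheorem6 {HA : Type*} {HB : Type*}
    [NormedAddCommGroup HA] [InnerProductSpace ℂ HA] [CompleteSpace HA]
    [NormedAddCommGroup HB] [InnerProductSpace ℂ HB] [CompleteSpace HB]
    (θ : QIT.HTensor HA HB →L[ℂ] QIT.HTensor HA HB) (hθ : QIT.IsState θ)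
    (ε γ : ℝ) (hε : ε ∈ Set.Ioo (0 : ℝ) 1) (hγ : γ ∈ Set.Ioo 0 ε) :
    QIT.altSmoothIMax ε θ ≤
      QIT.smoothDMax (ε - γ) θ (QIT.tensorOp (QIT.marginalA θ) (QIT.marginalB θ))
        + ((Real.logb 2 (3 / γ ^ 2) : ℝ) : EReal) := by
  have hpos : 0 < 3 / γ ^ 2 := by have := hγ.1; positivity
  -- With the finite constant moved to the left, the infimum on the right is bounded candidate by
  -- candidate; an empty set of candidates needs no separate case.
  rw [← EReal.sub_le_iff_le_add (Or.inl (EReal.coe_ne_bot _)) (Or.inl (EReal.coe_ne_top _))]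
  refine le_sInf ?_
  rintro _ ⟨l, ⟨ω, hω, hle, hP⟩, rfl⟩
  rw [EReal.sub_le_iff_le_add (Or.inl (EReal.coe_ne_bot _)) (Or.inl (EReal.coe_ne_top _)),
    ← EReal.coe_add]
  obtain ⟨θ', hθ', hP', hle'⟩ :=
    QIT.exists_state_le_tensorOp_marginalB hθ hω hε.2 hγ.1 hγ.2 hle hP
  refine (iInf_le_of_le θ' (iInf_le_of_le hθ' (iInf_le_of_le hP' ?_)))
  -- The exponent is `l + logb 2 (3 / γ ^ 2)`, which turns the sum into the factor `2 ^ l * (3 / γ ^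
  -- 2)`.
  refine sInf_le ⟨_, ?_, rfl⟩
  rw [Set.mem_ofPred_eq, Real.rpow_add two_pos, Real.rpow_logb two_pos (by norm_num) hpos]
  exact hle'
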